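/- Let $n \ge 0$, let $\mathsf{K} \subset \mathbb{R}^n$ be a nonempty compact convex set, and write $\mathrm{dist}_{\mathsf{K}}(x) = \min\{\|y-x\| : y \in \mathsf{K}\}$ for the Euclidean distance from $x$ to $\mathsf{K}$. Let $\mathsf{B}^k$ be the Euclidean unit ball of $\mathbb{R}^k$, $\kappa_k$ its volume ($\kappa_0 = 1$), and $\omega_k = k\kappa_k$ its surface area. The intrinsic volumes $\mathrm{V}_0(\mathsf{K}), \dots, \mathrm{V}_n(\mathsf{K})$ are the coefficients in Steiner's formula $$\mathrm{vol}_n(\mathsf{K} + \lambda \mathsf{B}^n) = \sum_{i=0}^n \lambda^{n-i}\,\kappa_{n-i}\,\mathrm{V}_i(\mathsf{K}) \quad\text{for all } \lambda \ge 0.$$ The rigid motion volumes and the total rigid motion volume of $\mathsf{K}$ are $$\bar{\mathrm{V}}_i(\mathsf{K}) = \frac{\omega_{n+1}}{\omega_{i+1}}\,\mathrm{V}_i(\mathsf{K}) \quad (0 \le i \le n), \qquad \bar{\mathrm{W}}(\mathsf{K}) = \sum_{i=0}^n \bar{\mathrm{V}}_i(\mathsf{K}),$$ and the central rigid motion volume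 $\bar\delta(\mathsf{K}) = \mathbb{E}\,\bar I_{\mathsf{K}}$ is the expectation of the random variable $\bar I_{\mathsf{K}}$ with $\mathbb{P}\{\bar I_{\mathsf{K}} = n-i\} = \bar{\mathrm{V}}_i(\mathsf{K})/\bar{\mathrm{W}}(\mathsf{K})$ for $i = 0, \dots, n$. Then $$\bar{\mathrm{W}}(\mathsf{K}) = \int_{\mathbb{R}^n} \big[1 + \mathrm{dist}_{\mathsf{K}}^2(x)\big]^{-(n+1)/2}\, dx$$ and $$(n+1) - \bar\delta(\mathsf{K}) = \frac{n+1}{\bar{\mathrm{W}}(\mathsf{K})} \int_{\mathbb{R}^n} \big[1 + \mathrm{dist}_{\mathsf{K}}^2(x)\big]^{-(n+3)/2}\, dx,$$ where both integrals are finite. -/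

import Mathlib

open MeasureTheory Metric
open scoped Pointwise

noncomputable section

namespace RigidMotionVolume

/-- `κ_k`, the `k`-dimensional volume of the Euclidean unit ball of `ℝ^k` (so `κ_0 = 1`). -/
def unitBallVolume (k : ℕ) : ℝ :=
  volume.real (closedBall (0 : EuclideanSpace ℝ (Fin k)) 1)

/-- `ω_k = k κ_k`, the surface area of the Euclidean unit ball of `ℝ^k`. -/
def unitBallSurface (k : ℕ) : ℝ :=
  k * unitBallVolume k

variable {n : ℕ}

/-- `V` is the list of coefficients in Steiner's formula for the convex body `K`:
`vol_n (K + t B) = ∑_{i=0}^n t^{n-i} κ_{n-i} V_i` for all `t ≥ 0`. -/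
def IsSteinerCoeff (K : ConvexBody (EuclideanSpace ℝ (Fin n))) (V : Fin (n + 1) → ℝ) : Prop :=
  ∀ t : ℝ, 0 ≤ t →
    volume.real ((K : Set (EuclideanSpace ℝ (Fin n))) +
        t • closedBall (0 : EuclideanSpace ℝ (Fin n)) 1) =
      ∑ i : Fin (n + 1), t ^ (n - (i : ℕ)) * unitBallVolume (n - (i : ℕ)) * V i

open Classical in
/-- The intrinsic volumes `V_0(K), …, V_n(K)`: the coefficients in Steiner's formula.
They are unique, see `IsSteinerCoeff.eq_intrinsicVolume`; the second branch
(no coefficients exist) is the default value `0`. -/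
def intrinsicVolume (K : ConvexBody (EuclideanSpace ℝ (Fin n))) : Fin (n + 1) → ℝ :=
  if h : ∃ V, IsSteinerCoeff K V then h.choose else 0

theorem unitBallVolume_pos (k : ℕ) : 0 < unitBallVolume k := by
  unfold unitBallVolume
  rw [measureReal_def]
  exact ENNReal.toReal_pos (measure_closedBall_pos _ _ one_pos).ne'
    (isCompact_closedBall _ _).measure_lt_top.ne

theorem IsSteinerCoeff.unique {K : ConvexBody (EuclideanSpace ℝ (Fin n))}
    {V W : Fin (n + 1) → ℝ} (hV : IsSteinerCoeff K V) (hW : IsSteinerCoeff K W) : V = W := by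
  let p : (Fin (n + 1) → ℝ) → Polynomial ℝ := fun U =>
    ∑ i : Fin (n + 1), Polynomial.monomial (n - (i : ℕ)) (unitBallVolume (n - (i : ℕ)) * U i)
  have hp : p V = p W := by
    apply Polynomial.eq_of_infinite_eval_eq
    refine (Set.Ici_infinite (0 : ℝ)).mono fun t ht => ?_
    have h := (hV t ht).symm.trans (hW t ht)
    simp only [Set.mem_ofPred_eq, p, Polynomial.eval_finsetSum, Polynomial.eval_monomial]
    calc _ = _ := Finset.sum_congr rfl fun i _ => by ring
      _ = _ := h
      _ = _ := Finset.sum_congr rfl fun i _ => by ring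
  have hc : ∀ (U : Fin (n + 1) → ℝ) (j : Fin (n + 1)),
      (p U).coeff (n - (j : ℕ)) = unitBallVolume (n - (j : ℕ)) * U j := by
    intro U j
    simp only [p, Polynomial.finsetSum_coeff, Polynomial.coeff_monomial]
    rw [Finset.sum_eq_single j]
    · simp
    · intro i _ hij
      rw [if_neg]
      intro h
      apply hij
      ext
      omega
    · simp
  funext j
  have h := hc V j
  rw [hp, hc W j] at h
  exact (mul_left_cancel₀ (unitBallVolume_pos _).ne' h).symm

theorem IsSteinerCoeff.eq_intrinsicVolume {K : ConvexBody (EuclideanSpace ℝ (Fin n))}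
    {V : Fin (n + 1) → ℝ} (hV : IsSteinerCoeff K V) : intrinsicVolume K = V := by
  have h : ∃ V, IsSteinerCoeff K V := ⟨V, hV⟩
  rw [intrinsicVolume, dif_pos h]
  exact h.choose_spec.unique hV

/-- The rigid motion volumes `V̄_i(K) = (ω_{n+1} / ω_{i+1}) V_i(K)`. -/
def rigidMotionVolume (K : ConvexBody (EuclideanSpace ℝ (Fin n))) (i : Fin (n + 1)) : ℝ :=
  unitBallSurface (n + 1) / unitBallSurface ((i : ℕ) + 1) * intrinsicVolume K i

/-- The total rigid motion volume `W̄(K) = ∑_{i=0}^n V̄_i(K)`. -/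
def totalRigidMotionVolume (K : ConvexBody (EuclideanSpace ℝ (Fin n))) : ℝ :=
  ∑ i : Fin (n + 1), rigidMotionVolume K i

/-- The distribution of the rigid motion volume random variable `Ī_K`:
it takes the value `n - i` with probability `V̄_i(K) / W̄(K)`, for `i = 0, …, n`. -/
def rigidMotionLaw (K : ConvexBody (EuclideanSpace ℝ (Fin n))) : Measure ℕ :=
  ∑ i : Fin (n + 1),
    ENNReal.ofReal (rigidMotionVolume K i / totalRigidMotionVolume K) •
      Measure.dirac (n - (i : ℕ))

/-- The central rigid motion volume `δ̄(K) = 𝔼 Ī_K`. -/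
def centralRigidMotionVolume (K : ConvexBody (EuclideanSpace ℝ (Fin n))) : ℝ :=
  ∫ k : ℕ, (k : ℝ) ∂(rigidMotionLaw K)

end RigidMotionVolume

end

/-! Two ingredients give the result: Steiner's formula with nonnegative coefficients, and a Gamma
integral.

Let `p` be the nearest-point map of `K`. For `t > 0` the normal dilation `x ↦ p x + t (x - p x)`
maps the parallel body at distance 1 bijectively onto the one at distance `t`. The map `p` is
1-Lipschitz, hence differentiable almost everywhere, and its derivative `A` is symmetric with
spectrum in `[0, 1]`, because `x - p x` is the gradient of half the squared distance. So the
Jacobian `det (A + t (1 - A))` is a polynomial in `t` with nonnegative coefficients, and integrating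
it gives `exists_polynomial_measure_cthickening`.

If the sublevel sets of `d` have measure `∑ c_i r ^ e_i`, the layer-cake formula gives the Laplace
transform of `d ^ 2`, and a further Gamma integral turns it into `∫ (1 + d ^ 2) ^ (-a)`
(`integral_one_add_sq_rpow_neg`). For `a = (n + 1) / 2` the Gamma factors are exactly `ω_{n+1} /
ω_{i+1}`. Raising `a` by one multiplies the `i`-th term by `(i + 1) / (n + 1)`, which yields the
expectation. -/

open scoped RealInnerProductSpace Polynomial Topology

/-- `p` maps every point to its nearest point in `s`, expressed by the variational inequality
that characterizes nearest points in convex sets. -/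
def IsNearestPointMap {E : Type*} [NormedAddCommGroup E] [InnerProductSpace ℝ E]
    (s : Set E) (p : E → E) : Prop :=
  ∀ x, p x ∈ s ∧ ∀ w ∈ s, ⟪x - p x, w - p x⟫ ≤ 0

/-- The homothety of ratio `t` along each normal ray issuing from its nearest point `p x`. -/
def normalDilation {E : Type*} [AddCommGroup E] [Module ℝ E] (p : E → E) (t : ℝ) (x : E) : E :=
  p x + t • (x - p x)

theorem mem_cthickening_iff_infDist_le {X : Type*} [PseudoMetricSpace X] {s : Set X}
    (hs : s.Nonempty) {r : ℝ} (hr : 0 ≤ r) {x : X} : x ∈ cthickening r s ↔ infDist x s ≤ r := by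
  rw [cthickening_eq_preimage_infEDist, Set.mem_preimage, Set.mem_Iic, infDist,
    ENNReal.le_ofReal_iff_toReal_le (infEDist_ne_top hs) hr]

/-! ### The nearest-point map and normal dilations. -/

section NearestPoint

variable {E : Type*} [NormedAddCommGroup E] [InnerProductSpace ℝ E] {s : Set E} {p : E → E}

theorem exists_isNearestPointMap (hne : s.Nonempty) (hc : IsComplete s) (hs : Convex ℝ s) :
    ∃ p : E → E, IsNearestPointMap s p := by
  choose p hp hpn using exists_norm_eq_iInf_of_complete_convex hne hc hs
  exact ⟨p, fun x => ⟨hp x, (norm_eq_iInf_iff_real_inner_le_zero hs (hp x)).1 (hpn x)⟩⟩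

namespace IsNearestPointMap

/-- Add the variational inequality at `x` tested on `p y` to the one at `y` tested on `p x`. -/
theorem norm_sq_le_inner (hp : IsNearestPointMap s p) (x y : E) :
    ‖p x - p y‖ ^ 2 ≤ ⟪p x - p y, x - y⟫ := by
  have h1 := (hp x).2 _ (hp y).1
  have h2 := (hp y).2 _ (hp x).1
  rw [← real_inner_self_eq_norm_sq]
  simp only [inner_sub_left, inner_sub_right] at *
  linarith [real_inner_comm (p x) x, real_inner_comm (p y) x, real_inner_comm (p x) y,
    real_inner_comm (p y) y, real_inner_comm (p y) (p x)]

theorem eq_of_inner_le (hp : IsNearestPointMap s p) {x v : E} (hv : v ∈ s)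
    (h : ∀ w ∈ s, ⟪x - v, w - v⟫ ≤ 0) : p x = v := by
  have h1 := (hp x).2 _ hv
  have h2 := h _ (hp x).1
  have : ‖p x - v‖ ^ 2 ≤ 0 := by
    rw [← real_inner_self_eq_norm_sq]
    simp only [inner_sub_left, inner_sub_right] at *
    linarith [real_inner_comm (p x) v]
  exact sub_eq_zero.1 (norm_eq_zero.1 (by nlinarith [norm_nonneg (p x - v)]))

/-- Scaling `x - p x` by a nonnegative factor preserves the variational inequality. Hence dilations
compose by multiplying ratios, and ratio `t⁻¹` inverts ratio `t`. -/
theorem apply_normalDilation (hp : IsNearestPointMap s p) {t : ℝ} (ht : 0 ≤ t) (x : E) :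
    p (normalDilation p t x) = p x := by
  refine hp.eq_of_inner_le (hp x).1 fun w hw => ?_
  rw [normalDilation, add_sub_cancel_left, real_inner_smul_left]
  exact mul_nonpos_of_nonneg_of_nonpos ht ((hp x).2 w hw)

theorem normalDilation_normalDilation (hp : IsNearestPointMap s p) {t : ℝ} (ht : 0 ≤ t)
    (r : ℝ) (x : E) : normalDilation p r (normalDilation p t x) = normalDilation p (r * t) x := by
  conv_lhs => rw [normalDilation, hp.apply_normalDilation ht]
  simp [normalDilation, smul_smul]

theorem lipschitzWith (hp : IsNearestPointMap s p) : LipschitzWith 1 p := by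
  refine LipschitzWith.of_dist_le_mul fun x y => ?_
  rw [dist_eq_norm, dist_eq_norm, NNReal.coe_one, one_mul]
  have h := (hp.norm_sq_le_inner x y).trans (real_inner_le_norm _ _)
  by_contra! hlt
  nlinarith [norm_nonneg (x - y), norm_nonneg (p x - p y)]

theorem infDist_eq (hp : IsNearestPointMap s p) (x : E) : infDist x s = ‖x - p x‖ := by
  refine le_antisymm ((infDist_le_dist_of_mem (hp x).1).trans_eq (dist_eq_norm _ _)) ?_
  refine (le_infDist ⟨_, (hp x).1⟩).2 fun w hw => ?_
  have h := (hp x).2 w hw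
  rw [dist_eq_norm]
  have e : x - w = (x - p x) - (w - p x) := by abel
  have := norm_sub_sq_real (x - p x) (w - p x)
  rw [← e] at this
  by_contra! hlt
  nlinarith [norm_nonneg (x - w), sq_nonneg ‖w - p x‖]

theorem infDist_normalDilation (hp : IsNearestPointMap s p) {t : ℝ} (ht : 0 ≤ t) (x : E) :
    infDist (normalDilation p t x) s = t * infDist x s := by
  rw [hp.infDist_eq, hp.apply_normalDilation ht, normalDilation, add_sub_cancel_left, norm_smul,
    Real.norm_of_nonneg ht, hp.infDist_eq]

theorem injective_normalDilation (hp : IsNearestPointMap s p) {t : ℝ} (ht : 0 < t) :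
    Function.Injective (normalDilation p t) := by
  refine Function.LeftInverse.injective (g := normalDilation p t⁻¹) fun x => ?_
  rw [hp.normalDilation_normalDilation ht.le, inv_mul_cancel₀ ht.ne']
  simp [normalDilation]

theorem image_normalDilation_cthickening (hp : IsNearestPointMap s p) {t : ℝ} (ht : 0 < t) :
    normalDilation p t '' cthickening 1 s = cthickening t s := by
  have hne : s.Nonempty := ⟨_, (hp 0).1⟩
  ext y
  simp only [Set.mem_image, mem_cthickening_iff_infDist_le hne zero_le_one,
    mem_cthickening_iff_infDist_le hne ht.le]
  constructor
  · rintro ⟨x, hx, rfl⟩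
    rw [hp.infDist_normalDilation ht.le]
    nlinarith
  · intro hy
    refine ⟨normalDilation p t⁻¹ y, ?_, ?_⟩
    · rw [hp.infDist_normalDilation (inv_nonneg.2 ht.le), inv_mul_le_iff₀ ht, mul_one]
      exact hy
    · rw [hp.normalDilation_normalDilation (inv_nonneg.2 ht.le), mul_inv_cancel₀ ht.ne']
      simp [normalDilation]

/-- The competitor `p a` bounds the distance at `b` from above. Using this for both `(x, y)` and
`(y, x)`, with `p` 1-Lipschitz, makes the first-order error `O(‖y - x‖ ^ 2)`, even where `p` is not
differentiable. -/
theorem hasFDerivAt_infDist_sq (hp : IsNearestPointMap s p) (x : E) :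
    HasFDerivAt (fun y => infDist y s ^ 2 / 2) (innerSL ℝ (x - p x)) x := by
  refine HasFDerivAt.of_isLittleO ?_
  have hO : (fun y => infDist y s ^ 2 / 2 - infDist x s ^ 2 / 2 - innerSL ℝ (x - p x) (y - x))
      =O[𝓝 x] fun y => ‖y - x‖ ^ 2 := by
    refine Asymptotics.IsBigO.of_bound 1 (Filter.Eventually.of_forall fun y => ?_)
    rw [Real.norm_eq_abs, one_mul, norm_pow, norm_norm, innerSL_apply_apply]
    have upper : ∀ a b : E, infDist b s ^ 2 ≤
        infDist a s ^ 2 + 2 * ⟪a - p a, b - a⟫ + ‖b - a‖ ^ 2 := by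
      intro a b
      have h1 : infDist b s ≤ ‖b - p a‖ :=
        (infDist_le_dist_of_mem (hp a).1).trans_eq (dist_eq_norm _ _)
      have e : b - p a = (a - p a) + (b - a) := by abel
      calc infDist b s ^ 2 ≤ ‖b - p a‖ ^ 2 := by gcongr; exact infDist_nonneg
        _ = _ := by rw [e, norm_add_sq_real, hp.infDist_eq a]
    have h1 := upper x y
    have h2 := upper y x
    have h4 : ‖p x - p y‖ ≤ ‖x - y‖ := by simpa [dist_eq_norm] using hp.lipschitzWith.dist_le_mul x y
    have h5 : ⟪p x - p y, x - y⟫ ≤ ‖x - y‖ ^ 2 := by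
      refine (real_inner_le_norm _ _).trans ?_
      nlinarith [norm_nonneg (x - y)]
    have h6 : ⟪y - p y, x - y⟫ = - ⟪x - p x, y - x⟫ + ⟪p x - p y, x - y⟫ - ‖x - y‖ ^ 2 := by
      rw [← real_inner_self_eq_norm_sq]
      simp only [inner_sub_left, inner_sub_right]
      ring
    have h7 : 0 ≤ ⟪p x - p y, x - y⟫ := (sq_nonneg _).trans (hp.norm_sq_le_inner x y)
    rw [norm_sub_rev x y] at *
    rw [abs_le]
    constructor <;> nlinarith [sq_nonneg ‖y - x‖]
  refine hO.trans_isLittleO ?_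
  have : Filter.Tendsto (fun y => y - x) (𝓝 x) (𝓝 0) := by
    simpa using (continuous_sub_right x).tendsto x
  exact ((Asymptotics.isLittleO_norm_pow_id one_lt_two).comp_tendsto this)

/-- `1 - A` is the second derivative at `x` of half the squared distance. -/
theorem isSymmetric_fderiv (hp : IsNearestPointMap s p) {x : E} {A : E →L[ℝ] E}
    (hA : HasFDerivAt p A x) : (A : E →ₗ[ℝ] E).IsSymmetric := by
  intro v w
  have h := second_derivative_symmetric (fun y => hp.hasFDerivAt_infDist_sq y)
    ((innerSL ℝ (E := E)).hasFDerivAt.comp x ((hasFDerivAt_id x).sub hA)) v w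
  have h' : ⟪v - A v, w⟫ = ⟪w - A w, v⟫ := h
  rw [inner_sub_left, inner_sub_left, real_inner_comm v w] at h'
  rw [ContinuousLinearMap.coe_coe, real_inner_comm (A w) v]
  linarith

/-- Limit of `norm_sq_le_inner` along difference quotients. On an eigenvector it reads `l ^ 2 ≤ l`,
so eigenvalues lie in `[0, 1]`. -/
theorem norm_sq_fderiv_le (hp : IsNearestPointMap s p) {x : E} {A : E →L[ℝ] E}
    (hA : HasFDerivAt p A x) (v : E) : ‖A v‖ ^ 2 ≤ ⟪A v, v⟫ := by
  have hlim := hA.lim_real v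
  refine le_of_tendsto_of_tendsto (hlim.norm.pow 2) (hlim.inner tendsto_const_nhds)
    (Filter.eventually_atTop.2 ⟨1, fun c hc => ?_⟩)
  have h := hp.norm_sq_le_inner (x + c⁻¹ • v) x
  have hc0 : c ≠ 0 := by positivity
  rw [add_sub_cancel_left, real_inner_smul_right] at h
  simp only [norm_smul, real_inner_smul_left, mul_pow, Real.norm_eq_abs, sq_abs]
  calc c ^ 2 * ‖p (x + c⁻¹ • v) - p x‖ ^ 2 ≤ c ^ 2 * (c⁻¹ * ⟪p (x + c⁻¹ • v) - p x, v⟫) := by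
        gcongr
    _ = _ := by field_simp

end IsNearestPointMap

end NearestPoint

/-! ### Polynomial Jacobians and their integrals. -/

theorem Polynomial.coeff_prod_nonneg {ι : Type*} (s : Finset ι) {f : ι → ℝ[X]}
    (hf : ∀ i ∈ s, ∀ j, 0 ≤ (f i).coeff j) (j : ℕ) : 0 ≤ (∏ i ∈ s, f i).coeff j := by
  revert j
  refine Finset.prod_induction f (fun q => ∀ j, 0 ≤ q.coeff j) (fun a b ha hb j => ?_)
    (fun j => ?_) hf
  · rw [Polynomial.coeff_mul]
    exact Finset.sum_nonneg fun i _ => mul_nonneg (ha _) (hb _)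
  · rw [Polynomial.coeff_one]
    split_ifs <;> norm_num

/-- In an orthonormal eigenbasis the operator is diagonal with entries `(1 - l i) * t + l i`, whose
coefficients are nonnegative. -/
theorem exists_polynomial_det_add_smul_sub {E : Type*} [NormedAddCommGroup E]
    [InnerProductSpace ℝ E] [FiniteDimensional ℝ E] {A : E →L[ℝ] E}
    (hA : (A : E →ₗ[ℝ] E).IsSymmetric) (hA' : ∀ v, ‖A v‖ ^ 2 ≤ ⟪A v, v⟫) :
    ∃ P : ℝ[X], P.natDegree ≤ Module.finrank ℝ E ∧ (∀ j, 0 ≤ P.coeff j) ∧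
      ∀ t : ℝ, (A + t • (ContinuousLinearMap.id ℝ E - A)).det = P.eval t := by
  let b := hA.eigenvectorBasis rfl
  let l := hA.eigenvalues rfl
  have hb : ∀ i, A (b i) = l i • b i := fun i => hA.apply_eigenvectorBasis rfl i
  have hl : ∀ i, 0 ≤ l i ∧ l i ≤ 1 := by
    intro i
    have h := hA' (b i)
    rw [hb, norm_smul, real_inner_smul_left, real_inner_self_eq_norm_sq, b.norm_eq_one,
      Real.norm_eq_abs, mul_one, sq_abs] at h
    constructor <;> nlinarith
  refine ⟨∏ i, (Polynomial.C (1 - l i) * Polynomial.X + Polynomial.C (l i)), ?_, ?_, ?_⟩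
  · refine (Polynomial.natDegree_prod_le _ _).trans
      ((Finset.sum_le_card_nsmul _ _ 1 fun i _ => Polynomial.natDegree_linear_le).trans ?_)
    simp
  · refine Polynomial.coeff_prod_nonneg _ fun i _ j => ?_
    rcases j with _ | _ | j
    · simpa using (hl i).1
    · simpa [Polynomial.coeff_C] using (hl i).2
    · simp [Polynomial.coeff_one]
  · intro t
    have hM : LinearMap.toMatrix b.toBasis b.toBasis
        ((A + t • (ContinuousLinearMap.id ℝ E - A) : E →L[ℝ] E) : E →ₗ[ℝ] E) =
        Matrix.diagonal fun i => (1 - l i) * t + l i := by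
      ext i j
      rw [LinearMap.toMatrix_apply]
      have : (A + t • (ContinuousLinearMap.id ℝ E - A)) (b j) = ((1 - l j) * t + l j) • b j := by
        simp only [add_apply, smul_apply,
          sub_apply, ContinuousLinearMap.id_apply, hb]
        module
      rw [ContinuousLinearMap.coe_coe, OrthonormalBasis.coe_toBasis, this, map_smul,
        ← OrthonormalBasis.coe_toBasis, Module.Basis.repr_self]
      by_cases h : i = j
      · subst h; simp
      · simp [h]
    rw [ContinuousLinearMap.det, ← LinearMap.det_toMatrix b.toBasis, hM, Matrix.det_diagonal,
      Polynomial.eval_prod]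
    simp

/-- Lagrange interpolation writes each coefficient as a fixed linear combination of finitely many
values, so integrability passes from values to coefficients. -/
theorem exists_polynomial_integral_eval {α : Type*} [MeasurableSpace α] {μ : Measure α}
    {P : α → ℝ[X]} {d : ℕ} (hd : ∀ x, (P x).natDegree ≤ d) (h0 : ∀ x j, 0 ≤ (P x).coeff j)
    (hint : ∀ t : ℝ, 0 < t → Integrable (fun x => (P x).eval t) μ) :
    ∃ Q : ℝ[X], Q.natDegree ≤ d ∧ (∀ j, 0 ≤ Q.coeff j) ∧
      ∀ t : ℝ, ∫ x, (P x).eval t ∂μ = Q.eval t := by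
  -- The nodes start at 1 because integrability is assumed only for `t > 0`.
  have hinj : Set.InjOn (fun k : ℕ => (k : ℝ) + 1) (Finset.range (d + 1)) :=
    fun a _ b _ h => by simpa using h
  have hcoeff : ∀ j, Integrable (fun x => (P x).coeff j) μ := by
    intro j
    have e : (fun x => (P x).coeff j) = fun x => ∑ k ∈ Finset.range (d + 1),
        (P x).eval ((k : ℝ) + 1) *
          (Lagrange.basis (Finset.range (d + 1)) (fun k : ℕ => (k : ℝ) + 1) k).coeff j := by
      funext x
      have hdeg : (P x).degree < (Finset.range (d + 1)).card := by
        rw [Finset.card_range]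
        exact (Polynomial.degree_le_of_natDegree_le (hd x)).trans_lt (by exact_mod_cast d.lt_succ_self)
      conv_lhs => rw [Lagrange.eq_interpolate hinj hdeg, Lagrange.interpolate_apply,
        Polynomial.finsetSum_coeff]
      simp only [Polynomial.coeff_C_mul]
    rw [e]
    exact integrable_finsetSum _ fun k _ => (hint _ (by positivity)).mul_const _
  refine ⟨∑ j ∈ Finset.range (d + 1), Polynomial.monomial j (∫ x, (P x).coeff j ∂μ), ?_, ?_, ?_⟩
  · refine Polynomial.natDegree_sum_le_of_forall_le _ _ fun j hj => ?_
    exact (Polynomial.natDegree_monomial_le _).trans (Nat.lt_succ_iff.1 (Finset.mem_range.1 hj))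
  · intro j
    rw [Polynomial.finsetSum_coeff]
    refine Finset.sum_nonneg fun k _ => ?_
    rw [Polynomial.coeff_monomial]
    split_ifs
    · exact integral_nonneg fun x => h0 x k
    · exact le_rfl
  · intro t
    have e : ∀ x, (P x).eval t = ∑ j ∈ Finset.range (d + 1), (P x).coeff j * t ^ j :=
      fun x => Polynomial.eval_eq_sum_range' (Nat.lt_succ_of_le (hd x)) t
    simp only [e, Polynomial.eval_finsetSum, Polynomial.eval_monomial]
    rw [integral_finsetSum _ fun j _ => (hcoeff j).mul_const _]
    simp only [integral_mul_const]

/-! ### Steiner's formula. -/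

/-- `μ` and the top-dimensional Hausdorff measure have the same null sets, and Lipschitz maps
preserve Hausdorff-null sets. -/
theorem LipschitzWith.addHaar_image_eq_zero {E : Type*} [NormedAddCommGroup E]
    [NormedSpace ℝ E] [FiniteDimensional ℝ E] [MeasurableSpace E] [BorelSpace E]
    (μ : Measure E) [μ.IsAddHaarMeasure] {C : NNReal} {f : E → E} (hf : LipschitzWith C f)
    {s : Set E} (hs : μ s = 0) : μ (f '' s) = 0 := by
  let ν : Measure E := Measure.hausdorffMeasure (Module.finrank ℝ E)
  have hμν : μ ≪ ν := Measure.absolutelyContinuous_isAddHaarMeasure μ ν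
  have hνμ : ν ≪ μ := Measure.absolutelyContinuous_isAddHaarMeasure ν μ
  refine hμν (le_antisymm ?_ zero_le)
  refine (hf.hausdorffMeasure_image_le (Nat.cast_nonneg _) s).trans_eq ?_
  rw [show Measure.hausdorffMeasure (Module.finrank ℝ E) s = 0 from hνμ hs, mul_zero]

/-- **Steiner's formula**: the volume of the parallel body at distance `t` of a compact convex set
is a polynomial in `t`, of degree at most the dimension and with nonnegative coefficients. -/
theorem exists_polynomial_measure_cthickening {E : Type*} [NormedAddCommGroup E]
    [InnerProductSpace ℝ E] [FiniteDimensional ℝ E] [MeasurableSpace E] [BorelSpace E]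
    (μ : Measure E) [μ.IsAddHaarMeasure] {K : Set E} (hK : IsCompact K) (hc : Convex ℝ K)
    (hne : K.Nonempty) :
    ∃ Q : ℝ[X], Q.natDegree ≤ Module.finrank ℝ E ∧ (∀ j, 0 ≤ Q.coeff j) ∧
      ∀ t : ℝ, 0 ≤ t → μ.real (cthickening t K) = Q.eval t := by
  obtain ⟨p, hp⟩ := exists_isNearestPointMap hne hK.isComplete hc
  let D : Set E := {x | DifferentiableAt ℝ p x}
  let T : Set E := cthickening 1 K ∩ D
  have hDm : MeasurableSet D := measurableSet_of_differentiableAt ℝ p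
  have hT : MeasurableSet T := isClosed_cthickening.measurableSet.inter hDm
  have hD : μ Dᶜ = 0 := hp.lipschitzWith.ae_differentiableAt
  have hP : ∀ x, ∃ P : ℝ[X], P.natDegree ≤ Module.finrank ℝ E ∧ (∀ j, 0 ≤ P.coeff j) ∧
      (x ∈ D → ∀ t : ℝ, (fderiv ℝ p x + t • (ContinuousLinearMap.id ℝ E - fderiv ℝ p x)).det
        = P.eval t) := by
    intro x
    by_cases hx : x ∈ D
    · have hd : HasFDerivAt p (fderiv ℝ p x) x := DifferentiableAt.hasFDerivAt hx
      obtain ⟨P, h1, h2, h3⟩ := exists_polynomial_det_add_smul_sub (hp.isSymmetric_fderiv hd)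
        (hp.norm_sq_fderiv_le hd)
      exact ⟨P, h1, h2, fun _ => h3⟩
    -- The default 0 keeps the degree and sign bounds valid at every point.
    · exact ⟨0, by simp, by simp, fun h => absurd h hx⟩
  choose P hPd hP0 hPe using hP
  have hnonneg : ∀ x, ∀ t : ℝ, 0 ≤ t → 0 ≤ (P x).eval t := fun x t ht => by
    rw [Polynomial.eval_eq_sum_range]
    exact Finset.sum_nonneg fun j _ => mul_nonneg (hP0 x j) (pow_nonneg ht j)
  -- `P` comes from choice; measurability is read off the determinant, which agrees with it on `T`.
  have hmeas : ∀ t : ℝ, AEStronglyMeasurable (fun x => (P x).eval t) (μ.restrict T) := by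
    intro t
    have h1 : Measurable fun x =>
        (fderiv ℝ p x + t • (ContinuousLinearMap.id ℝ E - fderiv ℝ p x)).det := by
      have h2 : Continuous fun A : E →L[ℝ] E => (A + t • (ContinuousLinearMap.id ℝ E - A)).det :=
        ContinuousLinearMap.continuous_det.comp (by fun_prop)
      exact h2.measurable.comp (measurable_fderiv ℝ p)
    refine h1.aestronglyMeasurable.congr ?_
    filter_upwards [ae_restrict_mem hT] with x hx using hPe x hx.2 t
  have hvol : ∀ t : ℝ, 0 < t →
      ∫⁻ x in T, ENNReal.ofReal ((P x).eval t) ∂μ = μ (cthickening t K) := by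
    intro t ht
    have hlip : ∃ C, LipschitzWith C (normalDilation p t) :=
      ⟨_, hp.lipschitzWith.add ((lipschitzWith_smul t).comp
        (LipschitzWith.id.sub hp.lipschitzWith))⟩
    obtain ⟨C, hC⟩ := hlip
    have h1 := lintegral_abs_det_fderiv_eq_addHaar_image μ hT (f := normalDilation p t)
      (f' := fun x => fderiv ℝ p x + t • (ContinuousLinearMap.id ℝ E - fderiv ℝ p x))
      (fun x hx => by
        have hd : HasFDerivAt p (fderiv ℝ p x) x := DifferentiableAt.hasFDerivAt hx.2
        exact (hd.add (((hasFDerivAt_id x).sub hd).const_smul t)).hasFDerivWithinAt)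
      (hp.injective_normalDilation ht).injOn
    have h2 : μ (normalDilation p t '' T) = μ (cthickening t K) := by
      rw [← hp.image_normalDilation_cthickening ht]
      refine le_antisymm (measure_mono (Set.image_mono Set.inter_subset_left)) ?_
      calc μ (normalDilation p t '' cthickening 1 K)
          ≤ μ (normalDilation p t '' T ∪ normalDilation p t '' Dᶜ) := by
            refine measure_mono ?_
            rw [← Set.image_union]
            refine Set.image_mono fun x hx => ?_
            by_cases h : x ∈ D
            exacts [Or.inl ⟨hx, h⟩, Or.inr h]
        _ ≤ μ (normalDilation p t '' T) + μ (normalDilation p t '' Dᶜ) := measure_union_le _ _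
        _ = μ (normalDilation p t '' T) := by rw [hC.addHaar_image_eq_zero μ hD, add_zero]
    rw [← h2, ← h1]
    refine setLIntegral_congr_fun hT fun x hx => ?_
    simp only [hPe x hx.2 t, abs_of_nonneg (hnonneg x t ht.le)]
  have hfin : ∀ t : ℝ, μ (cthickening t K) ≠ ⊤ := fun t => hK.cthickening.measure_lt_top.ne
  have hint : ∀ t : ℝ, 0 < t → Integrable (fun x => (P x).eval t) (μ.restrict T) := by
    intro t ht
    refine ⟨hmeas t, ?_⟩
    rw [hasFiniteIntegral_iff_ofReal (Filter.Eventually.of_forall fun x => hnonneg x t ht.le),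
      hvol t ht]
    exact (hfin t).lt_top
  obtain ⟨Q, hQd, hQ0, hQ⟩ := exists_polynomial_integral_eval hPd hP0 hint
  refine ⟨Q, hQd, hQ0, ?_⟩
  have hpos : ∀ t : ℝ, 0 < t → μ.real (cthickening t K) = Q.eval t := by
    intro t ht
    rw [← hQ, integral_eq_lintegral_of_nonneg_ae
      (Filter.Eventually.of_forall fun x => hnonneg x t ht.le) (hmeas t), hvol t ht, measureReal_def]
  intro t ht
  rcases ht.eq_or_lt with rfl | ht
  -- At `t = 0` the dilation collapses to `p`, so the value is obtained as a limit from the right.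
  · have h1 : Filter.Tendsto (fun r => μ.real (cthickening r K)) (𝓝[>] 0) (𝓝 (μ.real K)) :=
      (ENNReal.tendsto_toReal hK.measure_lt_top.ne).comp
        ((tendsto_measure_cthickening_of_isCompact hK).mono_left nhdsWithin_le_nhds)
    have h2 : Filter.Tendsto (fun r => Q.eval r) (𝓝[>] 0) (𝓝 (Q.eval 0)) :=
      (Q.continuous.tendsto 0).mono_left nhdsWithin_le_nhds
    rw [cthickening_zero, hK.isClosed.closure_eq]
    refine tendsto_nhds_unique h1 (h2.congr' ?_)
    filter_upwards [self_mem_nhdsWithin] with r hr using (hpos r hr).symm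
  · exact hpos t ht

/-! ### Gamma integrals and functions with polynomial sublevel measure. -/

theorem lintegral_rpow_mul_exp_neg_mul_Ioi {b r : ℝ} (hb : 0 < b) (hr : 0 < r) :
    ∫⁻ t in Set.Ioi (0 : ℝ), ENNReal.ofReal (t ^ (b - 1) * Real.exp (-(r * t))) =
      ENNReal.ofReal ((1 / r) ^ b * Real.Gamma b) := by
  have h := Real.integral_rpow_mul_exp_neg_mul_Ioi hb hr
  have hpos : 0 < (1 / r) ^ b * Real.Gamma b := mul_pos (by positivity) (Real.Gamma_pos_of_pos hb)
  rw [← h, ofReal_integral_eq_lintegral_ofReal]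
  -- A non-integrable function has Bochner integral 0, contradicting the positive value.
  · by_contra hni
    rw [integral_undef hni] at h
    exact hpos.ne h
  · filter_upwards [ae_restrict_mem measurableSet_Ioi] with t ht
    exact mul_nonneg (Real.rpow_nonneg (le_of_lt ht) _) (Real.exp_pos _).le

theorem lintegral_sum_rpow_mul_exp_neg_mul_Ioi {ι : Type*} [Fintype ι] {c b : ι → ℝ} {r : ℝ}
    (hc : ∀ i, 0 ≤ c i) (hb : ∀ i, 0 < b i) (hr : 0 < r) :
    ∫⁻ t in Set.Ioi (0 : ℝ), ENNReal.ofReal (∑ i, c i * (t ^ (b i - 1) * Real.exp (-(r * t)))) =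
      ENNReal.ofReal (∑ i, c i * ((1 / r) ^ b i * Real.Gamma (b i))) := by
  have hG : ∀ i, 0 ≤ (1 / r) ^ b i * Real.Gamma (b i) := fun i =>
    mul_nonneg (by positivity) (Real.Gamma_pos_of_pos (hb i)).le
  rw [ENNReal.ofReal_sum_of_nonneg fun i _ => mul_nonneg (hc i) (hG i)]
  have e : ∀ t ∈ Set.Ioi (0 : ℝ),
      ENNReal.ofReal (∑ i, c i * (t ^ (b i - 1) * Real.exp (-(r * t)))) =
        ∑ i, ENNReal.ofReal (c i) * ENNReal.ofReal (t ^ (b i - 1) * Real.exp (-(r * t))) := by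
    intro t ht
    have ht' : 0 ≤ t := le_of_lt ht
    rw [ENNReal.ofReal_sum_of_nonneg fun i _ => mul_nonneg (hc i) (by positivity)]
    exact Finset.sum_congr rfl fun i _ => ENNReal.ofReal_mul (hc i)
  rw [setLIntegral_congr_fun measurableSet_Ioi e, lintegral_finsetSum _ fun i _ => by fun_prop]
  refine Finset.sum_congr rfl fun i _ => ?_
  rw [lintegral_const_mul _ (by fun_prop), lintegral_rpow_mul_exp_neg_mul_Ioi (hb i) hr,
    ENNReal.ofReal_mul (hc i)]

theorem lintegral_mul_exp_neg_mul_Ici {s : ℝ} (hs : 0 < s) (u : ℝ) :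
    ∫⁻ v in Set.Ici u, ENNReal.ofReal (s * Real.exp (-(s * v))) =
      ENNReal.ofReal (Real.exp (-(s * u))) := by
  have hi : IntegrableOn (fun v => Real.exp (-s * v)) (Set.Ioi u) :=
    integrableOn_exp_mul_Ioi (neg_lt_zero.2 hs) u
  simp only [← neg_mul]
  rw [setLIntegral_congr Ioi_ae_eq_Ici.symm, ← ofReal_integral_eq_lintegral_ofReal
    (hi.const_mul s) (Filter.Eventually.of_forall fun v => by positivity), integral_const_mul,
    integral_exp_mul_Ioi (neg_lt_zero.2 hs)]
  congr 1
  field_simp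

section PolynomialGrowth

variable {α ι : Type*} [MeasurableSpace α] [Fintype ι] {μ : Measure α} [SFinite μ] {d : α → ℝ}
  {c : ι → ℝ} {e : ι → ℕ}

/-- Laplace transform of `d ^ 2` when the sublevel sets of `d` have polynomial measure. -/
theorem lintegral_exp_neg_mul_sq (hd : Measurable d) (hd0 : ∀ x, 0 ≤ d x) (hc : ∀ i, 0 ≤ c i)
    (hμ : ∀ r, 0 ≤ r → μ {x | d x ≤ r} = ENNReal.ofReal (∑ i, c i * r ^ e i)) {s : ℝ}
    (hs : 0 < s) :
    ∫⁻ x, ENNReal.ofReal (Real.exp (-(s * d x ^ 2))) ∂μ =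
      ENNReal.ofReal (∑ i, c i * Real.Gamma (e i / 2 + 1) * s ^ (-(e i : ℝ) / 2)) := by
  let h : ℝ → ENNReal := fun v => ENNReal.ofReal (s * Real.exp (-(s * v)))
  have hh : Measurable h := by fun_prop
  have hS : MeasurableSet {q : α × ℝ | d q.1 ^ 2 ≤ q.2} :=
    measurableSet_le (by fun_prop) measurable_snd
  have hF : Measurable fun q : α × ℝ => {q : α × ℝ | d q.1 ^ 2 ≤ q.2}.indicator (fun q => h q.2) q :=
    (hh.comp measurable_snd).indicator hS
  -- Layer cake: write `exp (-s d ^ 2)` as the integral of `s exp (-s v)` over `v ≥ d ^ 2`, then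
  -- apply Tonelli. The measure of `{d ≤ √v}` contributes powers `v ^ (e i / 2)`.
  calc ∫⁻ x, ENNReal.ofReal (Real.exp (-(s * d x ^ 2))) ∂μ
      = ∫⁻ x, (∫⁻ v, {q : α × ℝ | d q.1 ^ 2 ≤ q.2}.indicator (fun q => h q.2) (x, v)) ∂μ := by
        refine lintegral_congr fun x => ?_
        rw [← lintegral_mul_exp_neg_mul_Ici hs, ← lintegral_indicator measurableSet_Ici]
        rfl
    _ = ∫⁻ v, ∫⁻ x, {q : α × ℝ | d q.1 ^ 2 ≤ q.2}.indicator (fun q => h q.2) (x, v) ∂μ :=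
        lintegral_lintegral_swap hF.aemeasurable
    _ = ∫⁻ v, h v * μ {x | d x ^ 2 ≤ v} := by
        refine lintegral_congr fun v => ?_
        rw [← lintegral_indicator_const (measurableSet_le (by fun_prop) measurable_const)]
        rfl
    _ = ∫⁻ v in Set.Ici 0, h v * μ {x | d x ^ 2 ≤ v} := by
        rw [← lintegral_indicator measurableSet_Ici]
        refine lintegral_congr fun v => ?_
        by_cases hv : 0 ≤ v
        · rw [Set.indicator_of_mem (Set.mem_Ici.2 hv)]
        · rw [Set.indicator_of_notMem (by simpa using hv)]
          have : {x | d x ^ 2 ≤ v} = ∅ :=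
            Set.eq_empty_of_forall_notMem fun x hx => hv ((sq_nonneg _).trans hx)
          rw [this, measure_empty, mul_zero]
    _ = ∫⁻ v in Set.Ioi 0, h v * μ {x | d x ^ 2 ≤ v} := setLIntegral_congr Ioi_ae_eq_Ici.symm
    _ = ∫⁻ v in Set.Ioi 0, ENNReal.ofReal (∑ i, (s * c i) *
          (v ^ (((e i : ℝ) / 2 + 1) - 1) * Real.exp (-(s * v)))) := by
        refine setLIntegral_congr_fun measurableSet_Ioi fun v hv => ?_
        have hv' : 0 ≤ v := le_of_lt hv
        have hset : {x | d x ^ 2 ≤ v} = {x | d x ≤ √v} := by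
          ext x
          exact (Real.le_sqrt (hd0 x) hv').symm
        simp only [h, hset]
        rw [hμ _ (Real.sqrt_nonneg v), ← ENNReal.ofReal_mul (by positivity), Finset.mul_sum]
        congr 1
        refine Finset.sum_congr rfl fun i _ => ?_
        rw [Real.sqrt_eq_rpow, ← Real.rpow_natCast, ← Real.rpow_mul hv', add_sub_cancel_right,
          one_div_mul_eq_div]
        ring
    _ = _ := by
        rw [lintegral_sum_rpow_mul_exp_neg_mul_Ioi (fun i => mul_nonneg hs.le (hc i))
          (fun i => by positivity) hs]
        congr 1
        refine Finset.sum_congr rfl fun i _ => ?_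
        rw [one_div, Real.inv_rpow hs.le, ← Real.rpow_neg hs.le,
          show -((e i : ℝ) / 2 + 1) = -(e i : ℝ) / 2 - 1 by ring, Real.rpow_sub_one hs.ne']
        field_simp

/-- Integral of `(1 + d ^ 2) ^ (-a)` when the sublevel sets of `d` have polynomial measure. -/
theorem lintegral_one_add_sq_rpow_neg (hd : Measurable d) (hd0 : ∀ x, 0 ≤ d x)
    (hc : ∀ i, 0 ≤ c i)
    (hμ : ∀ r, 0 ≤ r → μ {x | d x ≤ r} = ENNReal.ofReal (∑ i, c i * r ^ e i)) {a : ℝ} (ha : 0 < a)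
    (hae : ∀ i, (e i : ℝ) / 2 < a) :
    ∫⁻ x, ENNReal.ofReal ((1 + d x ^ 2) ^ (-a)) ∂μ =
      ENNReal.ofReal (∑ i, c i * Real.Gamma (e i / 2 + 1) * Real.Gamma (a - e i / 2) /
        Real.Gamma a) := by
  have hΓ := Real.Gamma_pos_of_pos ha
  let k : ℝ → ENNReal := fun s => ENNReal.ofReal ((Real.Gamma a)⁻¹ * (s ^ (a - 1) * Real.exp (-s)))
  have hk : Measurable k := by fun_prop
  have hF : Measurable fun q : α × ℝ =>
      k q.2 * ENNReal.ofReal (Real.exp (-(q.2 * d q.1 ^ 2))) := by fun_prop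
  -- `(1 + d ^ 2) ^ (-a)` is a Gamma-weighted average of `exp (-s d ^ 2)` over `s > 0`. After
  -- Tonelli, `hae` is what makes `s ^ (a - e i / 2 - 1)` integrable at 0.
  calc ∫⁻ x, ENNReal.ofReal ((1 + d x ^ 2) ^ (-a)) ∂μ
      = ∫⁻ x, (∫⁻ s in Set.Ioi 0, k s * ENNReal.ofReal (Real.exp (-(s * d x ^ 2)))) ∂μ := by
        refine lintegral_congr fun x => ?_
        have hr : 0 < 1 + d x ^ 2 := by positivity
        have h1 := lintegral_rpow_mul_exp_neg_mul_Ioi ha hr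
        have h2 : ENNReal.ofReal ((1 + d x ^ 2) ^ (-a)) = ENNReal.ofReal (Real.Gamma a)⁻¹ *
            ENNReal.ofReal ((1 / (1 + d x ^ 2)) ^ a * Real.Gamma a) := by
          rw [← ENNReal.ofReal_mul (by positivity), one_div, Real.inv_rpow hr.le,
            ← Real.rpow_neg hr.le]
          congr 1
          field_simp
        rw [h2, ← h1, ← lintegral_const_mul _ (by fun_prop)]
        refine setLIntegral_congr_fun measurableSet_Ioi fun s hs => ?_
        have hs' : 0 ≤ s := le_of_lt hs
        simp only [k]
        rw [← ENNReal.ofReal_mul (by positivity), ← ENNReal.ofReal_mul (by positivity), mul_assoc,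
          mul_assoc, ← Real.exp_add]
        congr 4
        ring
    _ = ∫⁻ s in Set.Ioi 0, ∫⁻ x, k s * ENNReal.ofReal (Real.exp (-(s * d x ^ 2))) ∂μ :=
        lintegral_lintegral_swap hF.aemeasurable
    _ = ∫⁻ s in Set.Ioi 0, ENNReal.ofReal (∑ i,
          ((Real.Gamma a)⁻¹ * (c i * Real.Gamma (e i / 2 + 1))) *
            (s ^ ((a - e i / 2) - 1) * Real.exp (-(1 * s)))) := by
        refine setLIntegral_congr_fun measurableSet_Ioi fun s hs => ?_
        have hs' : 0 < s := hs
        simp only [k]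
        rw [lintegral_const_mul _ (by fun_prop), lintegral_exp_neg_mul_sq hd hd0 hc hμ hs',
          ← ENNReal.ofReal_mul (by positivity), Finset.mul_sum]
        congr 1
        refine Finset.sum_congr rfl fun i _ => ?_
        rw [show a - (e i : ℝ) / 2 - 1 = (a - 1) + -(e i : ℝ) / 2 by ring, Real.rpow_add hs',
          one_mul]
        ring
    _ = _ := by
        rw [lintegral_sum_rpow_mul_exp_neg_mul_Ioi (fun i => mul_nonneg (by positivity)
          (mul_nonneg (hc i) (Real.Gamma_pos_of_pos (by positivity)).le))
          (fun i => sub_pos.2 (hae i)) one_pos]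
        congr 1
        refine Finset.sum_congr rfl fun i _ => ?_
        rw [one_div_one, Real.one_rpow]
        ring

theorem integrable_one_add_sq_rpow_neg (hd : Measurable d) (hd0 : ∀ x, 0 ≤ d x)
    (hc : ∀ i, 0 ≤ c i)
    (hμ : ∀ r, 0 ≤ r → μ {x | d x ≤ r} = ENNReal.ofReal (∑ i, c i * r ^ e i)) {a : ℝ} (ha : 0 < a)
    (hae : ∀ i, (e i : ℝ) / 2 < a) : Integrable (fun x => (1 + d x ^ 2) ^ (-a)) μ := by
  refine ⟨(by fun_prop : Measurable _).aestronglyMeasurable, ?_⟩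
  rw [hasFiniteIntegral_iff_ofReal (Filter.Eventually.of_forall fun x => by positivity),
    lintegral_one_add_sq_rpow_neg hd hd0 hc hμ ha hae]
  exact ENNReal.ofReal_lt_top

theorem integral_one_add_sq_rpow_neg (hd : Measurable d) (hd0 : ∀ x, 0 ≤ d x)
    (hc : ∀ i, 0 ≤ c i)
    (hμ : ∀ r, 0 ≤ r → μ {x | d x ≤ r} = ENNReal.ofReal (∑ i, c i * r ^ e i)) {a : ℝ} (ha : 0 < a)
    (hae : ∀ i, (e i : ℝ) / 2 < a) :
    ∫ x, (1 + d x ^ 2) ^ (-a) ∂μ =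
      ∑ i, c i * Real.Gamma (e i / 2 + 1) * Real.Gamma (a - e i / 2) / Real.Gamma a := by
  rw [integral_eq_lintegral_of_nonneg_ae (Filter.Eventually.of_forall fun x => by positivity)
    (by fun_prop : Measurable _).aestronglyMeasurable,
    lintegral_one_add_sq_rpow_neg hd hd0 hc hμ ha hae, ENNReal.toReal_ofReal]
  refine Finset.sum_nonneg fun i _ => ?_
  have h1 := Real.Gamma_pos_of_pos ha
  have h2 := Real.Gamma_pos_of_pos (sub_pos.2 (hae i))
  have h3 : 0 < Real.Gamma ((e i : ℝ) / 2 + 1) := Real.Gamma_pos_of_pos (by positivity)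
  have := hc i
  positivity

end PolynomialGrowth

/-! ### Intrinsic volumes and rigid motion volumes. -/

namespace RigidMotionVolume

theorem unitBallVolume_eq (k : ℕ) :
    unitBallVolume k = √Real.pi ^ k / Real.Gamma (k / 2 + 1) := by
  have hΓ : 0 < Real.Gamma ((k : ℝ) / 2 + 1) := Real.Gamma_pos_of_pos (by positivity)
  rw [unitBallVolume, measureReal_def]
  rcases Nat.eq_zero_or_pos k with rfl | hk
  · simp [volume_euclideanSpace_eq_dirac]
  have : Nonempty (Fin k) := ⟨⟨0, hk⟩⟩
  rw [EuclideanSpace.volume_closedBall, ENNReal.ofReal_one,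
    one_pow, one_mul, Fintype.card_fin, ENNReal.toReal_ofReal (by positivity)]

theorem unitBallVolume_mul_Gamma (k : ℕ) :
    unitBallVolume k * Real.Gamma (k / 2 + 1) = √Real.pi ^ k := by
  rw [unitBallVolume_eq, div_mul_cancel₀ _ (Real.Gamma_pos_of_pos (by positivity)).ne']

theorem unitBallSurface_succ (k : ℕ) :
    unitBallSurface (k + 1) = 2 * √Real.pi ^ (k + 1) / Real.Gamma (((k : ℝ) + 1) / 2) := by
  have hΓ : 0 < Real.Gamma (((k : ℝ) + 1) / 2) := Real.Gamma_pos_of_pos (by positivity)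
  rw [unitBallSurface, unitBallVolume_eq]
  push_cast
  rw [Real.Gamma_add_one (by positivity)]
  field_simp

variable {n : ℕ}

theorem unitBallSurface_div (i : Fin (n + 1)) :
    unitBallSurface (n + 1) / unitBallSurface ((i : ℕ) + 1) =
      √Real.pi ^ (n - (i : ℕ)) * Real.Gamma (((i : ℝ) + 1) / 2) /
        Real.Gamma (((n : ℝ) + 1) / 2) := by
  have h1 : 0 < Real.Gamma (((n : ℝ) + 1) / 2) := Real.Gamma_pos_of_pos (by positivity)
  have h2 : 0 < Real.Gamma (((i : ℝ) + 1) / 2) := Real.Gamma_pos_of_pos (by positivity)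
  have hπ : 0 < √Real.pi := Real.sqrt_pos.2 Real.pi_pos
  have e : √Real.pi ^ (n + 1) = √Real.pi ^ (n - (i : ℕ)) * √Real.pi ^ ((i : ℕ) + 1) := by
    rw [← pow_add]
    congr 1
    omega
  rw [unitBallSurface_succ, unitBallSurface_succ, e]
  field_simp

theorem exists_isSteinerCoeff_nonneg (K : ConvexBody (EuclideanSpace ℝ (Fin n))) :
    ∃ V, IsSteinerCoeff K V ∧ ∀ i, 0 ≤ V i := by
  obtain ⟨Q, hd, h0, hQ⟩ :=
    exists_polynomial_measure_cthickening volume K.isCompact K.convex K.nonempty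
  rw [finrank_euclideanSpace_fin] at hd
  -- Steiner's formula indexes by codimension, hence the reflection of the sum over powers of `t`.
  refine ⟨fun i => Q.coeff (n - i) / unitBallVolume (n - i), fun t ht => ?_,
    fun i => div_nonneg (h0 _) (unitBallVolume_pos _).le⟩
  rw [smul_unitClosedBall_of_nonneg ht, K.isCompact.add_closedBall_zero ht, hQ t ht,
    Polynomial.eval_eq_sum_range' (Nat.lt_succ_of_le hd), ← Finset.sum_range_reflect,
    Finset.sum_range]
  refine Finset.sum_congr rfl fun i _ => ?_
  rw [mul_assoc, mul_div_cancel₀ _ (unitBallVolume_pos _).ne', mul_comm]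
  simp

theorem isSteinerCoeff_intrinsicVolume (K : ConvexBody (EuclideanSpace ℝ (Fin n))) :
    IsSteinerCoeff K (intrinsicVolume K) := by
  obtain ⟨V, hV, -⟩ := exists_isSteinerCoeff_nonneg K
  rwa [hV.eq_intrinsicVolume]

theorem intrinsicVolume_nonneg (K : ConvexBody (EuclideanSpace ℝ (Fin n))) (i : Fin (n + 1)) :
    0 ≤ intrinsicVolume K i := by
  obtain ⟨V, hV, h0⟩ := exists_isSteinerCoeff_nonneg K
  rw [hV.eq_intrinsicVolume]
  exact h0 i

theorem rigidMotionVolume_nonneg (K : ConvexBody (EuclideanSpace ℝ (Fin n))) (i : Fin (n + 1)) :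
    0 ≤ rigidMotionVolume K i := by
  refine mul_nonneg (div_nonneg ?_ ?_) (intrinsicVolume_nonneg K i) <;>
  exact mul_nonneg (Nat.cast_nonneg _) (unitBallVolume_pos _).le

theorem volume_setOf_infDist_le (K : ConvexBody (EuclideanSpace ℝ (Fin n))) {t : ℝ} (ht : 0 ≤ t) :
    volume {x | infDist x (K : Set (EuclideanSpace ℝ (Fin n))) ≤ t} =
      ENNReal.ofReal (∑ i : Fin (n + 1),
        (unitBallVolume (n - (i : ℕ)) * intrinsicVolume K i) * t ^ (n - (i : ℕ))) := by
  have h := isSteinerCoeff_intrinsicVolume K t ht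
  rw [smul_unitClosedBall_of_nonneg ht, K.isCompact.add_closedBall_zero ht] at h
  have hset : {x | infDist x (K : Set (EuclideanSpace ℝ (Fin n))) ≤ t} = cthickening t K :=
    Set.ext fun x => (mem_cthickening_iff_infDist_le K.nonempty ht).symm
  rw [hset, ← ofReal_measureReal K.isCompact.cthickening.measure_lt_top.ne, h]
  congr 1
  exact Finset.sum_congr rfl fun i _ => by ring

section Integral

variable (K : ConvexBody (EuclideanSpace ℝ (Fin n))) {a : ℝ}

theorem integrable_one_add_infDist_sq_rpow_neg (ha : (n : ℝ) / 2 < a) :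
    Integrable fun x : EuclideanSpace ℝ (Fin n) =>
      (1 + infDist x (K : Set (EuclideanSpace ℝ (Fin n))) ^ 2) ^ (-a) :=
  integrable_one_add_sq_rpow_neg (e := fun i : Fin (n + 1) => n - (i : ℕ))
    (continuous_infDist_pt _).measurable (fun _ => infDist_nonneg)
    (fun i => mul_nonneg (unitBallVolume_pos _).le (intrinsicVolume_nonneg K i))
    (fun _ hr => volume_setOf_infDist_le K hr) (lt_of_le_of_lt (by positivity) ha)
    (fun i => lt_of_le_of_lt (by gcongr; omega) ha)

/-- The factor `Γ(k / 2 + 1)` from the Laplace transform cancels the denominator of `κ_k`, leaving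
`√π ^ k` with `k = n - i`. -/
theorem integral_one_add_infDist_sq_rpow_neg (ha : (n : ℝ) / 2 < a) :
    ∫ x : EuclideanSpace ℝ (Fin n),
      (1 + infDist x (K : Set (EuclideanSpace ℝ (Fin n))) ^ 2) ^ (-a) =
      ∑ i : Fin (n + 1), √Real.pi ^ (n - (i : ℕ)) * Real.Gamma (a - (n - i) / 2) /
        Real.Gamma a * intrinsicVolume K i := by
  rw [integral_one_add_sq_rpow_neg (e := fun i : Fin (n + 1) => n - (i : ℕ))
    (continuous_infDist_pt _).measurable (fun _ => infDist_nonneg)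
    (fun i => mul_nonneg (unitBallVolume_pos _).le (intrinsicVolume_nonneg K i))
    (fun _ hr => volume_setOf_infDist_le K hr) (lt_of_le_of_lt (by positivity) ha)
    (fun i => lt_of_le_of_lt (by gcongr; omega) ha)]
  refine Finset.sum_congr rfl fun i _ => ?_
  rw [← unitBallVolume_mul_Gamma, Nat.cast_sub (Nat.lt_succ_iff.1 i.2)]
  ring

theorem totalRigidMotionVolume_eq_integral :
    totalRigidMotionVolume K = ∫ x : EuclideanSpace ℝ (Fin n),
      (1 + infDist x (K : Set (EuclideanSpace ℝ (Fin n))) ^ 2) ^ (-(((n : ℝ) + 1) / 2)) := by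
  rw [integral_one_add_infDist_sq_rpow_neg K (by linarith), totalRigidMotionVolume]
  refine Finset.sum_congr rfl fun i _ => ?_
  rw [rigidMotionVolume, unitBallSurface_div,
    show ((n : ℝ) + 1) / 2 - (n - i) / 2 = ((i : ℝ) + 1) / 2 by ring]

/-- The integral representation has a strictly positive integrand; this justifies dividing by
`W̄(K)`. -/
theorem totalRigidMotionVolume_pos : 0 < totalRigidMotionVolume K := by
  rw [totalRigidMotionVolume_eq_integral]
  have hpos : ∀ x : EuclideanSpace ℝ (Fin n),
      0 < (1 + infDist x (K : Set (EuclideanSpace ℝ (Fin n))) ^ 2) ^ (-(((n : ℝ) + 1) / 2)) :=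
    fun x => by positivity
  rw [integral_pos_iff_support_of_nonneg (fun x => (hpos x).le)
    (integrable_one_add_infDist_sq_rpow_neg K (by linarith))]
  rw [show Function.support _ = Set.univ from Set.eq_univ_of_forall fun x => (hpos x).ne']
  exact Measure.measure_univ_pos.2 (NeZero.ne _)

/-- Passing from `a = (n + 1) / 2` to `a + 1`, the recursion `Γ(z + 1) = z Γ(z)` in numerator and
denominator produces `(i + 1) / (n + 1)`. -/
theorem sum_succ_mul_rigidMotionVolume :
    ∑ i : Fin (n + 1), ((i : ℝ) + 1) * rigidMotionVolume K i =
      ((n : ℝ) + 1) * ∫ x : EuclideanSpace ℝ (Fin n),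
        (1 + infDist x (K : Set (EuclideanSpace ℝ (Fin n))) ^ 2) ^ (-(((n : ℝ) + 3) / 2)) := by
  rw [integral_one_add_infDist_sq_rpow_neg K (by linarith), Finset.mul_sum]
  refine Finset.sum_congr rfl fun i _ => ?_
  have h1 : 0 < Real.Gamma (((n : ℝ) + 1) / 2) := Real.Gamma_pos_of_pos (by positivity)
  rw [rigidMotionVolume, unitBallSurface_div,
    show ((n : ℝ) + 3) / 2 - (n - i) / 2 = ((i : ℝ) + 1) / 2 + 1 by ring,
    show ((n : ℝ) + 3) / 2 = ((n : ℝ) + 1) / 2 + 1 by ring,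
    Real.Gamma_add_one (by positivity), Real.Gamma_add_one (by positivity)]
  field_simp

theorem centralRigidMotionVolume_eq_sum :
    centralRigidMotionVolume K =
      ∑ i : Fin (n + 1), rigidMotionVolume K i / totalRigidMotionVolume K * (n - i) := by
  rw [centralRigidMotionVolume, rigidMotionLaw, integral_finsetSum_measure fun i _ =>
    (integrable_dirac enorm_lt_top).smul_measure ENNReal.ofReal_ne_top]
  refine Finset.sum_congr rfl fun i _ => ?_
  rw [integral_smul_measure, integral_dirac, ENNReal.toReal_ofReal
    (div_nonneg (rigidMotionVolume_nonneg K i) (totalRigidMotionVolume_pos K).le),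
    Nat.cast_sub (Nat.lt_succ_iff.1 i.2), smul_eq_mul]

/-- The weights sum to 1 and `(n + 1) - (n - i) = i + 1`, which reduces this to
`sum_succ_mul_rigidMotionVolume`. -/
theorem succ_sub_centralRigidMotionVolume :
    ((n : ℝ) + 1) - centralRigidMotionVolume K =
      ((n : ℝ) + 1) / totalRigidMotionVolume K * ∫ x : EuclideanSpace ℝ (Fin n),
        (1 + infDist x (K : Set (EuclideanSpace ℝ (Fin n))) ^ 2) ^ (-(((n : ℝ) + 3) / 2)) := by
  have hW := totalRigidMotionVolume_pos K
  rw [div_mul_eq_mul_div, ← sum_succ_mul_rigidMotionVolume, centralRigidMotionVolume_eq_sum,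
    eq_div_iff hW.ne', sub_mul, Finset.sum_mul]
  conv_lhs => enter [1]; rw [totalRigidMotionVolume, Finset.mul_sum]
  rw [← Finset.sum_sub_distrib]
  refine Finset.sum_congr rfl fun i _ => ?_
  field_simp
  ring

end Integral

end RigidMotionVolume

theorem proposition3p4 (n : ℕ) (K : ConvexBody (EuclideanSpace ℝ (Fin n))) :
    (Integrable (fun x : EuclideanSpace ℝ (Fin n) =>
        (1 + infDist x (K : Set (EuclideanSpace ℝ (Fin n))) ^ 2) ^ (-((n : ℝ) + 1) / 2)) ∧
      RigidMotionVolume.totalRigidMotionVolume K =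
        ∫ x : EuclideanSpace ℝ (Fin n),
          (1 + infDist x (K : Set (EuclideanSpace ℝ (Fin n))) ^ 2) ^ (-((n : ℝ) + 1) / 2)) ∧
    (Integrable (fun x : EuclideanSpace ℝ (Fin n) =>
        (1 + infDist x (K : Set (EuclideanSpace ℝ (Fin n))) ^ 2) ^ (-((n : ℝ) + 3) / 2)) ∧
      ((n : ℝ) + 1) - RigidMotionVolume.centralRigidMotionVolume K =
        ((n : ℝ) + 1) / RigidMotionVolume.totalRigidMotionVolume K *
          ∫ x : EuclideanSpace ℝ (Fin n),
            (1 + infDist x (K : Set (EuclideanSpace ℝ (Fin n))) ^ 2) ^ (-((n : ℝ) + 3) / 2)) := by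
  rw [neg_div, neg_div]
  exact ⟨⟨RigidMotionVolume.integrable_one_add_infDist_sq_rpow_neg K (by linarith),
      RigidMotionVolume.totalRigidMotionVolume_eq_integral K⟩,
    RigidMotionVolume.integrable_one_add_infDist_sq_rpow_neg K (by linarith),
    RigidMotionVolume.succ_sub_centralRigidMotionVolume K⟩
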